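/- Let $q$ be a prime number, let $(k_n)_n$ be integers with $0\le k_n\le n$, and suppose that the rate $R:=\lim_{n\to\infty}\frac{k_n}{n}\log_2 q$ exists. For every $n$ let $\mathbf d_n\in\mathbb F_q^n$ be a fixed vector and let $\mathbf G_n\in\mathbb F_q^{n\times k_n}$ be a random matrix with independent entries, uniformly distributed on $\mathbb F_q$. Put $\mathcal C^{(n)}=\{\mathbf G_n\mathbf m:\mathbf m\in\mathbb F_q^{k_n}\}$ and $\mathcal C'^{(n)}=\{\mathbf t\oplus\mathbf d_n:\mathbf t\in\mathcal C^{(n)}\}$ (with $\oplus$ the addition in $\mathbb F_q^n$), and regard both as subsets of $\{0,\dots,q-1\}^n\subset\mathbb Z^n$. Let $\mathcal C^{(n)}+\mathcal C'^{(n)}=\{\mathbf t+\mathbf v:\mathbf t\in\mathcal C^{(n)},\mathbf v\in\mathcal C'^{(n)}\}\subset\mathbb Z^n$, with addition in $\mathbb Z^n$, and, given $\mathbf G_n$, let $P_{\mathcal S}$ be the distribution of $T_1+T_2$ on it, where $T_1,T_2$ are independent and uniformly distributed on $\mathcal C'^{(n)}$ and $\mathcal C^{(n)}$ respectively. Let $$D(q):=H(U_1+U_2)-\log_2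 q,$$ where $U_1,U_2$ are independent and uniform on $\{0,\dots,q-1\}$, $U_1+U_2$ is their sum in $\mathbb Z$, and $H$ is the entropy in bits. Let $$b:=\begin{cases}2R, & R\le D(q),\\ R+D(q), & R>D(q).\end{cases}$$ Then asymptotically almost surely $\mathcal C^{(n)}$, $\mathcal C'^{(n)}$ have typical sumsets of size $\doteq 2^{nb}$ on which $P_{\mathcal S}\doteq 2^{-nb}$. Precisely: there are deterministic sequences $\epsilon_n\searrow 0$ and $\eta_n\to 0$ such that the probability, over $\mathbf G_n$, that there exists a set $\mathcal K\subseteq\mathcal C^{(n)}+\mathcal C'^{(n)}$ with 1. $P_{\mathcal S}(\mathcal K)\ge 1-\eta_n$, 2. $2^{n(b-\epsilon_n)}\le|\mathcal K|\le 2^{n(b+\epsilon_n)}$, 3. $2^{-n(b+\epsilon_n)}\le P_{\mathcal S}(\mathbf w)\le 2^{-n(b-\epsilon_n)}$ for all $\mathbf w\in\mathcal K$, tends to $1$ as $n\to\infty$. -/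

import Mathlib

open MeasureTheory ProbabilityTheory Filter Topology
open scoped Pointwise

namespace LinearSumset

noncomputable section

/-- The law of `T₁ + T₂`, where `T₁` and `T₂` are independent and uniformly distributed on
`A` and `B` respectively. -/
def sumLaw {α : Type*} [MeasurableSpace α] [Add α] (A B : Set α) : Measure α :=
  ((uniformOn A).prod (uniformOn B)).map (fun p => p.1 + p.2)

/-- The alphabet `{0, …, q - 1}`, as a set of integers. -/
def alphabet (q : ℕ) : Set ℤ := Set.Ico 0 (q : ℤ)

/-- The law `P_W` of `W = U₁ + U₂`, with `U₁, U₂` independent and uniform on `{0, …, q - 1}`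
and the sum taken in `ℤ`. -/
def lawW (q : ℕ) : Measure ℤ := sumLaw (alphabet q) (alphabet q)

/-- The entropy (in bits) of `W`, which takes values in `{0, …, 2q - 2}`. -/
def entropyW (q : ℕ) : ℝ :=
  -∑ a ∈ Finset.Icc (0 : ℤ) (2 * (q : ℤ) - 2),
    (lawW q).real {a} * Real.logb 2 ((lawW q).real {a})

/-- The threshold `D(q) = H(U₁ + U₂) - log₂ q`. -/
def threshold (q : ℕ) : ℝ := entropyW q - Real.logb 2 q

/-- A vector over `ℤ/q`, viewed as an integer vector with entries in `{0, …, q - 1}`. -/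
def intVec {q n : ℕ} (x : Fin n → ZMod q) : Fin n → ℤ := fun i => ((x i).val : ℤ)

/-- The code `{G m : m ∈ F_q^k}` generated by `G`, as a set of integer vectors. -/
def code {q n k : ℕ} (G : Matrix (Fin n) (Fin k) (ZMod q)) : Set (Fin n → ℤ) :=
  intVec '' Set.range (fun m : Fin k → ZMod q => G.mulVec m)

/-- The coset `{G m ⊕ d : m ∈ F_q^k}` of the code generated by `G`, as a set of integer
vectors; the addition of `d` is modulo `q`. -/
def coset {q n k : ℕ} (G : Matrix (Fin n) (Fin k) (ZMod q)) (d : Fin n → ZMod q) :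
    Set (Fin n → ℤ) :=
  intVec '' Set.range (fun m : Fin k → ZMod q => G.mulVec m + d)

/-- The induced distribution `P_S` on `C' + C`: the law of the integer sum of two independent
vectors that are uniform on the coset `C'` and on the code `C`. -/
def inducedLaw {q n k : ℕ} (G : Matrix (Fin n) (Fin k) (ZMod q)) (d : Fin n → ZMod q) :
    Measure (Fin n → ℤ) :=
  sumLaw (coset G d) (code G)

/-- The law of a random `n × k` array with independent entries, each uniform on `ℤ/q`. -/
def generatorLaw (q n k : ℕ) : Measure (Fin n → Fin k → ZMod q) :=
  Measure.pi fun _ => Measure.pi fun _ => uniformOn Set.univ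

/-- `2 ^ (n (b - ε)) ≤ a ≤ 2 ^ (n (b + ε))`. -/
def ExpClose (n : ℕ) (ε a b : ℝ) : Prop :=
  (2 : ℝ) ^ ((n : ℝ) * (b - ε)) ≤ a ∧ a ≤ (2 : ℝ) ^ ((n : ℝ) * (b + ε))

/-- The exponent of the size of a normal typical sumset of a code of rate `R` and its coset. -/
def sumsetExponent (q : ℕ) (R : ℝ) : ℝ :=
  if R ≤ threshold q then 2 * R else R + threshold q

/-- `K` is a subset of the sumset `C + C'` that contains the sum of two independent uniform
codewords with probability at least `1 - η`, whose size is `2 ^ (n b)` up to the factor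
`2 ^ (± n ε)`, and all of whose points have induced probability `2 ^ (- n b)` up to the same
factor; here `b` is `sumsetExponent q R`. -/
structure IsNormalTypical {q n k : ℕ} (R ε η : ℝ) (G : Matrix (Fin n) (Fin k) (ZMod q))
    (d : Fin n → ZMod q) (K : Set (Fin n → ℤ)) : Prop where
  subset : K ⊆ code G + coset G d
  typical : 1 - η ≤ (inducedLaw G d).real K
  size : ExpClose n ε (K.ncard : ℝ) (sumsetExponent q R)
  aep : ∀ w ∈ K, ExpClose n ε ((inducedLaw G d).real {w}) (-sumsetExponent q R)

end

end LinearSumset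

namespace LinearSumset

noncomputable section

open Finset BigOperators Matrix

/-!
The mass of a sum `w` under the induced law is its number of representations by a coset word and a
codeword, divided by `q ^ (2 * k)`. When two messages are linearly independent, their codewords are
independent and uniform, so up to probability `(q + 1) / q ^ k` a random sum `w = T₁ + T₂` looks
like the sum of two uniform vectors, and by Chebyshev's inequality it has `2 ^ (n * H)`
representations over the full space, up to `2 ^ (± n * δ)`, where `H = logb 2 q - D` is the
conditional entropy of `(U₁, U₂)` given `U₁ + U₂`.

*No sum is too likely.* Messages outside the span of the two given ones have codewords independent
of `w`, so about `q ^ 2 + q ^ k * 2 ^ (n * H) / q ^ n` of the messages fit into a representation of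
`w`, and by Markov's inequality the mass of `w` exceeds `2 ^ (- n * min (2 * R) (R + D))` by an
exponential factor only with small probability.

*No sum is too unlikely.* For `R ≤ D` every sum has mass at least `1 / q ^ (2 * k)`. For `R > D`,
reducing `w = T₁ + T₂` modulo `q` shows that `w` is congruent to a word of the same coset; only a
fraction `q ^ k / q ^ n` of the at most `q ^ (2 * n) / 2 ^ (n * H)` typical vectors has this
property, so there are too few of them for those of mass below `2 ^ (- n * (R + D))` to matter.
-/

section Averages

/-- The Iverson bracket of a proposition: the probability of an event under a uniform variable `x`
is written `𝔼 x, ind (P x)`. -/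
def ind (P : Prop) : ℝ := open Classical in if P then 1 else 0

lemma ind_pos {P : Prop} (h : P) : ind P = 1 := if_pos h

lemma ind_neg {P : Prop} (h : ¬P) : ind P = 0 := if_neg h

lemma ind_nonneg (P : Prop) : 0 ≤ ind P := by
  unfold ind; split_ifs <;> norm_num

lemma ind_le_one (P : Prop) : ind P ≤ 1 := by
  unfold ind; split_ifs <;> norm_num

lemma ind_le_of_imp {P : Prop} {x : ℝ} (hx : 0 ≤ x) (h : P → 1 ≤ x) : ind P ≤ x := by
  unfold ind; split_ifs with hP
  exacts [h hP, hx]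

lemma ind_mono {P Q : Prop} (h : P → Q) : ind P ≤ ind Q :=
  ind_le_of_imp (ind_nonneg Q) fun hP => (ind_pos (h hP)).ge

lemma ind_le_sum {ι : Type*} [Fintype ι] {P : Prop} {Q : ι → Prop} (h : P → ∃ i, Q i) :
    ind P ≤ ∑ i, ind (Q i) := by
  refine ind_le_of_imp (Finset.sum_nonneg fun i _ => ind_nonneg _) fun hP => ?_
  obtain ⟨i, hi⟩ := h hP
  exact (ind_pos hi).ge.trans
    (Finset.single_le_sum (f := fun i => ind (Q i)) (fun i _ => ind_nonneg _) (mem_univ i))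

lemma sum_ind {ι : Type*} (s : Finset ι) (P : ι → Prop) [DecidablePred P] :
    ∑ i ∈ s, ind (P i) = #{i ∈ s | P i} := by
  rw [← Finset.sum_boole]
  exact Finset.sum_congr rfl fun i _ => by unfold ind; congr

variable {V : Type*} [Fintype V]

lemma expect_ind_eq_card_div (P : V → Prop) [DecidablePred P] :
    𝔼 v, ind (P v) = #{v | P v} / Fintype.card V := by
  rw [Fintype.expect_eq_sum_div_card, sum_ind]

lemma expect_ind_eq (x : V) : 𝔼 v, ind (v = x) = 1 / Fintype.card V := by
  classical
  rw [expect_ind_eq_card_div, univ.filter_eq' x, if_pos (mem_univ x), card_singleton, Nat.cast_one]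

lemma one_sub_expect_div_le_expect_ind [Nonempty V] {X : V → ℝ} (hX : ∀ v, 0 ≤ X v) {η : ℝ}
    (hη : 0 < η) {P : V → Prop} (hP : ∀ v, X v ≤ η → P v) :
    1 - (𝔼 v, X v) / η ≤ 𝔼 v, ind (P v) := by
  have pointwise (v : V) : 1 - X v / η ≤ ind (P v) := by
    by_cases hv : X v ≤ η
    · rw [ind_pos (hP v hv), sub_le_self_iff]
      exact div_nonneg (hX v) hη.le
    · linarith [ind_nonneg (P v), (one_le_div hη).2 (not_le.1 hv).le]
  calc 1 - (𝔼 v, X v) / η = 𝔼 v, (1 - X v / η) := by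
        rw [Finset.expect_sub_distrib, Fintype.expect_const, Finset.expect_div]
    _ ≤ 𝔼 v, ind (P v) := Finset.expect_le_expect fun v _ => pointwise v

end Averages

section UniformLaws

lemma pi_uniformOn_univ {V ι : Type*} [Finite V] [MeasurableSpace V] [MeasurableSingletonClass V]
    [Fintype ι] :
    Measure.pi (fun _ : ι => uniformOn (Set.univ : Set V)) = uniformOn Set.univ := by
  rw [← Set.pi_univ Set.univ, uniformOn_pi]

variable {V : Type*} [Fintype V] [MeasurableSpace V] [MeasurableSingletonClass V]

lemma uniformOn_univ_real_apply (S : Set V) :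
    (uniformOn (Set.univ : Set V)).real S = 𝔼 v, ind (v ∈ S) := by
  classical
  rw [expect_ind_eq_card_div, measureReal_def, uniformOn_univ, ENNReal.toReal_div,
    Measure.count_apply_finite S (Set.toFinite S)]
  simp only [ENNReal.toReal_natCast]
  congr 3
  ext; simp

lemma integral_uniformOn_univ (f : V → ℝ) :
    ∫ v, f v ∂uniformOn (Set.univ : Set V) = 𝔼 v, f v := by
  rw [integral_fintype .of_finite, Fintype.expect_eq_sum_div_card, Finset.sum_div]
  refine Finset.sum_congr rfl fun v _ => ?_
  rw [uniformOn_univ_real_apply]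
  simp only [Set.mem_singleton_iff]
  rw [expect_ind_eq, smul_eq_mul, one_div_mul_eq_div]

lemma prod_uniformOn_univ {V W : Type*} [Finite V] [MeasurableSpace V]
    [MeasurableSingletonClass V] [Finite W] [MeasurableSpace W] [MeasurableSingletonClass W]
    [Nonempty V] [Nonempty W] :
    (uniformOn (Set.univ : Set V)).prod (uniformOn (Set.univ : Set W)) = uniformOn Set.univ := by
  have := Fintype.ofFinite V
  have := Fintype.ofFinite W
  refine Measure.ext_of_singleton fun ⟨v, w⟩ => (measureReal_eq_measureReal_iff).1 ?_
  rw [← Set.singleton_prod_singleton, measureReal_prod_prod]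
  simp only [uniformOn_univ_real_apply, Set.singleton_prod_singleton, Set.mem_singleton_iff,
    expect_ind_eq, Fintype.card_prod, Nat.cast_mul, one_div_mul_one_div]

lemma map_uniformOn_univ_eq_uniformOn_range [Nonempty V] {α : Type*} [DecidableEq α]
    [MeasurableSpace α] [Countable α] [MeasurableSingletonClass α] {f : V → α} {c : ℕ}
    (hf : ∀ x, #{v | f v = f x} = c) :
    (uniformOn (Set.univ : Set V)).map f = uniformOn (Set.range f) := by
  have hmeas : Measurable f := measurable_of_finite f
  have : IsProbabilityMeasure (uniformOn (Set.range f)) :=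
    isProbabilityMeasure_uniformOn (Set.finite_range f) (Set.range_nonempty f)
  have : IsProbabilityMeasure ((uniformOn (Set.univ : Set V)).map f) :=
    Measure.isProbabilityMeasure_map hmeas.aemeasurable
  refine Measure.ext_of_singleton fun a => (measureReal_eq_measureReal_iff).1 ?_
  rw [map_measureReal_apply hmeas (measurableSet_singleton a), uniformOn_univ_real_apply]
  simp only [Set.mem_preimage, Set.mem_singleton_iff]
  have hrange : Set.range f = (univ.image f : Finset α) := by simp
  rw [expect_ind_eq_card_div, measureReal_def, hrange, ← coe_singleton, uniformOn_apply_finset,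
    ENNReal.toReal_div]
  by_cases ha : a ∈ univ.image f
  · obtain ⟨x, -, rfl⟩ := mem_image.1 ha
    have card_V : Fintype.card V = #(univ.image f) * c := by
      rw [← card_univ, card_eq_sum_card_image f univ, ← smul_eq_mul, ← sum_const]
      exact Finset.sum_congr rfl fun b hb => by
        obtain ⟨y, -, rfl⟩ := mem_image.1 hb
        exact hf y
    have hc : (c : ℝ) ≠ 0 := by
      rw [← hf x, Nat.cast_ne_zero, card_ne_zero]
      exact ⟨x, by simp⟩
    rw [hf x, inter_singleton_of_mem ha, card_V, card_singleton]
    simp [div_mul_cancel_right₀ hc]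
  · have fibre_empty : #{v | f v = a} = 0 := by
      rw [card_eq_zero, filter_eq_empty_iff]
      rintro v - rfl
      exact ha (mem_image_of_mem f (mem_univ v))
    simp [fibre_empty, inter_singleton_of_notMem ha]

lemma sumLaw_range {W : Type*} [Fintype W] [MeasurableSpace W] [MeasurableSingletonClass W]
    [Nonempty V] [Nonempty W] {α : Type*} [DecidableEq α] [MeasurableSpace α] [Countable α]
    [MeasurableSingletonClass α] [Add α] {f : V → α} {g : W → α} {c c' : ℕ}
    (hf : ∀ x, #{v | f v = f x} = c) (hg : ∀ y, #{w | g w = g y} = c') :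
    sumLaw (Set.range f) (Set.range g) =
      (uniformOn (Set.univ : Set (V × W))).map fun p => f p.1 + g p.2 := by
  have hmf : Measurable f := measurable_of_finite f
  have hmg : Measurable g := measurable_of_finite g
  rw [sumLaw, ← map_uniformOn_univ_eq_uniformOn_range hf,
    ← map_uniformOn_univ_eq_uniformOn_range hg, Measure.map_prod_map _ _ hmf hmg,
    Measure.map_map (measurable_of_countable _) (hmf.prodMap hmg), prod_uniformOn_univ]
  rfl

end UniformLaws

section Concentration

lemma pi_real_le_abs_sum_sub_le {Ω ι : Type*} [MeasurableSpace Ω] [Fintype ι] {μ : Measure Ω}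
    [IsProbabilityMeasure μ] {X : Ω → ℝ} (hX : MemLp X 2 μ) {c : ℝ} (hc : 0 < c) :
    (Measure.pi fun _ : ι => μ).real {ω | c ≤ |∑ i, X (ω i) - Fintype.card ι * ∫ x, X x ∂μ|} ≤
      Fintype.card ι * Var[X; μ] / c ^ 2 := by
  have memLp_coord (i : ι) : MemLp (fun ω : ι → Ω => X (ω i)) 2 (Measure.pi fun _ => μ) :=
    hX.comp_measurePreserving (measurePreserving_eval _ i)
  have mean : ∫ ω : ι → Ω, ∑ i, X (ω i) ∂(Measure.pi fun _ => μ) =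
      Fintype.card ι * ∫ x, X x ∂μ := by
    rw [integral_finsetSum _ fun i _ => (memLp_coord i).integrable one_le_two]
    simp_rw [fun i : ι => integral_comp_eval (μ := fun _ : ι => μ) (i := i) hX.1]
    rw [sum_const, card_univ, nsmul_eq_mul]
  have variance : Var[fun ω : ι → Ω => ∑ i, X (ω i); Measure.pi fun _ => μ] =
      Fintype.card ι * Var[X; μ] := by
    have := variance_sum_pi (μ := fun _ : ι => μ) (X := fun _ => X) fun _ => hX
    rw [sum_const, card_univ, nsmul_eq_mul] at this
    rw [← this]
    congr 1
    ext ω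
    simp
  have chebyshev := meas_ge_le_variance_div_sq
    (memLp_finsetSum univ fun i _ => memLp_coord i) hc
  rw [mean, variance] at chebyshev
  exact ENNReal.toReal_le_of_le_ofReal (by have := variance_nonneg X μ; positivity) chebyshev

lemma measureReal_mem_and_singleton_lt_le {α : Type*} [MeasurableSpace α]
    [MeasurableSingletonClass α] (ν : Measure α) [IsFiniteMeasure ν] (T : Finset α) {a : ℝ}
    (ha : 0 ≤ a) : ν.real {w | w ∈ T ∧ ν.real {w} < a} ≤ #T * a := by
  classical
  calc ν.real {w | w ∈ T ∧ ν.real {w} < a} = ∑ w ∈ T with ν.real {w} < a, ν.real {w} := by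
        rw [sum_measureReal_singleton]
        congr 1
        ext; simp
    _ ≤ #{w ∈ T | ν.real {w} < a} * a := by
        rw [← nsmul_eq_mul]
        exact sum_le_card_nsmul _ _ _ fun w hw => (mem_filter.1 hw).2.le
    _ ≤ #T * a := by gcongr; exact filter_subset _ _

end Concentration

section KernelCount

variable {R m κ : Type*} [Ring R] [Fintype R] [Fintype κ] [DecidableEq κ]

/-- The number of vectors killed by `G`, as a real number. -/
def kernelCount (G : Matrix m κ R) : ℝ := ∑ x : κ → R, ind (G *ᵥ x = 0)

lemma kernelCount_nonneg (G : Matrix m κ R) : 0 ≤ kernelCount G :=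
  Finset.sum_nonneg fun _ _ => ind_nonneg _

lemma card_fibre_mulVec [DecidableEq (m → R)] (G : Matrix m κ R) (x : κ → R) :
    #{z | G *ᵥ z = G *ᵥ x} = #{z | G *ᵥ z = 0} :=
  card_equiv (Equiv.subRight x) fun z => by simp [mulVec_sub, sub_eq_zero]

lemma sum_ind_mulVec_eq_le (G : Matrix m κ R) (t : m → R) :
    ∑ x : κ → R, ind (G *ᵥ x = t) ≤ kernelCount G := by
  classical
  by_cases ht : ∃ x, G *ᵥ x = t
  · obtain ⟨x, rfl⟩ := ht
    rw [kernelCount, sum_ind, sum_ind]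
    exact_mod_cast (card_fibre_mulVec G x).le
  · rw [Finset.sum_eq_zero fun x _ => ind_neg fun hx => ht ⟨x, hx⟩]
    exact kernelCount_nonneg G

end KernelCount

section UniformMatrix

variable {F m κ : Type*} [Field F] [Fintype F] [Fintype m] [DecidableEq m]
  [Fintype κ] [DecidableEq κ]

/-- Shifting `G` by `t ⊗ φ`, where the functional `φ` kills `v` and takes the value `1` at `c`,
adds `t` to `G *ᵥ c` without changing the `G *ᵥ v i`. -/
lemma expect_mulVec_of_notMem_span {ι : Type*} {v : ι → κ → F}
    {c : κ → F} (hc : c ∉ Submodule.span F (Set.range v)) (f : (m → F) → (ι → m → F) → ℝ) :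
    𝔼 G : Matrix m κ F, f (G *ᵥ c) (fun i => G *ᵥ v i) =
      𝔼 G : Matrix m κ F, 𝔼 t : m → F, f t fun i => G *ᵥ v i := by
  obtain ⟨φ, φ_c, φ_span⟩ := Submodule.exists_le_ker_of_notMem hc
  obtain ⟨u, rfl⟩ := (dotProductEquiv F κ).surjective φ
  replace φ_c : u ⬝ᵥ c ≠ 0 := φ_c
  have φ_v (i : ι) : u ⬝ᵥ v i = 0 := φ_span (Submodule.subset_span ⟨i, rfl⟩)
  have shift (t : m → F) : 𝔼 G : Matrix m κ F, f (G *ᵥ c) (fun i => G *ᵥ v i) =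
      𝔼 G : Matrix m κ F, f (G *ᵥ c + t) fun i => G *ᵥ v i := by
    refine (Fintype.expect_equiv (Equiv.addRight (vecMulVec ((u ⬝ᵥ c)⁻¹ • t) u)) _ _
      fun G => ?_).symm
    simp only [Equiv.coe_addRight, add_mulVec, vecMulVec_mulVec, φ_v, op_smul_eq_smul, smul_smul,
      mul_inv_cancel₀ φ_c, one_smul, zero_mul, zero_smul, add_zero]
  calc 𝔼 G : Matrix m κ F, f (G *ᵥ c) (fun i => G *ᵥ v i)
      = 𝔼 t : m → F, 𝔼 G : Matrix m κ F, f (G *ᵥ c + t) fun i => G *ᵥ v i := by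
        rw [Finset.expect_congr rfl fun t _ => (shift t).symm, Fintype.expect_const]
    _ = 𝔼 G : Matrix m κ F, 𝔼 t : m → F, f (G *ᵥ c + t) fun i => G *ᵥ v i :=
        Finset.expect_comm ..
    _ = 𝔼 G : Matrix m κ F, 𝔼 t : m → F, f t fun i => G *ᵥ v i :=
        Finset.expect_congr rfl fun G _ =>
          Fintype.expect_equiv (Equiv.addLeft (G *ᵥ c)) _ _ fun t => rfl

lemma expect_mulVec {c : κ → F} (hc : c ≠ 0) (f : (m → F) → ℝ) :
    𝔼 G : Matrix m κ F, f (G *ᵥ c) = 𝔼 t, f t := by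
  rw [expect_mulVec_of_notMem_span (v := Fin.elim0) (by simpa using hc) fun t _ => f t,
    Fintype.expect_const]

lemma expect_mulVec_pair {x y : κ → F}
    (h : LinearIndependent F ![x, y]) (f : (m → F) → (m → F) → ℝ) :
    𝔼 G : Matrix m κ F, f (G *ᵥ x) (G *ᵥ y) = 𝔼 s, 𝔼 t, f s t := by
  obtain ⟨hy, hxy⟩ := linearIndependent_fin2.1 h
  have x_notMem : x ∉ Submodule.span F (Set.range fun _ : Unit => y) := by
    rw [Set.range_const, Submodule.mem_span_singleton]
    rintro ⟨a, ha⟩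
    exact hxy a ha
  rw [expect_mulVec_of_notMem_span x_notMem fun s t => f s (t ()),
    expect_mulVec (c := y) hy fun t => 𝔼 s, f s t, Finset.expect_comm]

lemma expect_not_linearIndependent_le :
    𝔼 p : (κ → F) × (κ → F), ind (¬LinearIndependent F ![p.1, p.2]) ≤
      (Fintype.card F + 1) / (Fintype.card F : ℝ) ^ Fintype.card κ := by
  classical
  have union (p : (κ → F) × (κ → F)) : ind (¬LinearIndependent F ![p.1, p.2]) ≤
      ind (p.2 = 0) + ∑ a : F, ind (p.1 = a • p.2) := by
    by_cases hp : p.2 = 0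
    · rw [ind_pos hp]
      have := Finset.sum_nonneg fun (a : F) (_ : a ∈ univ) => ind_nonneg (p.1 = a • p.2)
      linarith [ind_le_one (¬LinearIndependent F ![p.1, p.2])]
    · rw [ind_neg hp, zero_add]
      refine ind_le_sum fun h => ?_
      simpa [linearIndependent_fin2, hp, eq_comm] using h
  have expect_pair (P : (κ → F) → (κ → F) → Prop) :
      𝔼 p : (κ → F) × (κ → F), ind (P p.1 p.2) = 𝔼 y, 𝔼 x, ind (P x y) := by
    rw [← univ_product_univ, Finset.expect_product, Finset.expect_comm]
  have := Finset.expect_le_expect (s := univ) fun p _ => union p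
  refine this.trans_eq ?_
  rw [Finset.expect_add_distrib, Finset.expect_sum_comm, expect_pair fun _ y => y = 0]
  simp_rw [fun a : F => expect_pair fun x y => x = a • y, Fintype.expect_const, expect_ind_eq,
    Fintype.expect_const, sum_const, card_univ, nsmul_eq_mul, Fintype.card_pi, prod_const,
    card_univ, Nat.cast_pow]
  ring

lemma expect_ind_mulVec_eq {c : κ → F} (hc : c ≠ 0) (t : m → F) :
    𝔼 G : Matrix m κ F, ind (G *ᵥ c = t) = 1 / (Fintype.card F : ℝ) ^ Fintype.card m := by
  rw [expect_mulVec hc fun s => ind (s = t), expect_ind_eq, Fintype.card_fun, Nat.cast_pow]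

lemma expect_kernelCount_le :
    𝔼 G : Matrix m κ F, kernelCount G ≤
      1 + (Fintype.card F : ℝ) ^ Fintype.card κ / (Fintype.card F : ℝ) ^ Fintype.card m := by
  classical
  have expect_ind_le (x : κ → F) : 𝔼 G : Matrix m κ F, ind (G *ᵥ x = 0) ≤
      ind (x = 0) + 1 / (Fintype.card F : ℝ) ^ Fintype.card m := by
    by_cases hx : x = 0
    · rw [ind_pos hx]
      exact (Finset.expect_le univ_nonempty fun G _ => ind_le_one _).trans
        (le_add_of_nonneg_right (by positivity))
    · rw [ind_neg hx, zero_add, expect_ind_mulVec_eq hx]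
  unfold kernelCount
  rw [Finset.expect_sum_comm]
  refine (Finset.sum_le_sum fun x _ => expect_ind_le x).trans_eq ?_
  rw [Finset.sum_add_distrib, sum_ind, univ.filter_eq' 0, if_pos (mem_univ _), card_singleton,
    sum_const, card_univ, Fintype.card_fun, nsmul_eq_mul, mul_one_div]
  push_cast
  rfl

lemma sum_ind_mem_span_pair_le (x y : κ → F) :
    ∑ c : κ → F, ind (c ∈ Submodule.span F (Set.range ![x, y])) ≤ (Fintype.card F : ℝ) ^ 2 := by
  classical
  have span_subset : ({c | c ∈ Submodule.span F (Set.range ![x, y])} : Finset (κ → F)) ⊆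
      univ.image fun a : F × F => a.1 • x + a.2 • y := fun c hc => by
    rw [mem_filter, range_cons_cons_empty, Submodule.mem_span_pair] at hc
    obtain ⟨-, a, b, rfl⟩ := hc
    exact mem_image.2 ⟨(a, b), mem_univ _, rfl⟩
  have card_le := (card_le_card span_subset).trans card_image_le
  rw [card_univ, Fintype.card_prod, ← sq] at card_le
  rw [sum_ind]
  exact_mod_cast card_le

end UniformMatrix

section Representations

variable {V α : Type*} [Fintype V] [DecidableEq α]

/-- The number of pairs `(x, y)` with `f x + f y = w`. -/
def reprCount [Add α] (f : V → α) (w : α) : ℕ := #{p : V × V | f p.1 + f p.2 = w}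

lemma reprCount_pos [Add α] (f : V → α) (x y : V) : 0 < reprCount f (f x + f y) :=
  card_pos.2 ⟨(x, y), by simp⟩

lemma reprCount_eq_card_of_injective [Add α] [IsRightCancelAdd α] {f : V → α}
    (hf : Function.Injective f) (w : α) [DecidablePred fun y => ∃ x, f x + f y = w] :
    reprCount f w = #{y | ∃ x, f x + f y = w} := by
  refine card_bij (fun p _ => p.2) (fun p hp => ?_) (fun p hp p' hp' h => ?_) fun y hy => ?_
  · exact mem_filter.2 ⟨mem_univ _, p.1, (mem_filter.1 hp).2⟩
  · have sums_eq := (mem_filter.1 hp).2.trans (mem_filter.1 hp').2.symm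
    rw [h] at sums_eq
    exact Prod.ext (hf (add_right_cancel sums_eq)) h
  · obtain ⟨x, hx⟩ := (mem_filter.1 hy).2
    exact ⟨(x, y), mem_filter.2 ⟨mem_univ _, hx⟩, rfl⟩

lemma reprCount_le_card [Add α] [IsRightCancelAdd α] {f : V → α} (hf : Function.Injective f)
    (w : α) : reprCount f w ≤ Fintype.card V := by
  classical
  rw [reprCount_eq_card_of_injective hf]
  exact card_le_univ _

lemma reprCount_comp_left {ι : Type*} [Fintype ι] [DecidableEq ι] [Add α] (f : V → α)
    (w : ι → α) : reprCount (fun x : ι → V => f ∘ x) w = ∏ i, reprCount f (w i) := by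
  unfold reprCount
  rw [← Fintype.card_piFinset]
  refine card_equiv (Equiv.arrowProdEquivProdArrow ι (fun _ => V) fun _ => V).symm fun p => ?_
  simp [funext_iff]

lemma sum_reprCount_mul [Add α] {f : V → α} {T : Finset α} (hT : ∀ x y, f x + f y ∈ T)
    (φ : α → ℝ) : ∑ w ∈ T, reprCount f w * φ w = ∑ p : V × V, φ (f p.1 + f p.2) := by
  rw [← Finset.sum_fiberwise_of_maps_to (s := univ) (g := fun p : V × V => f p.1 + f p.2)
    fun p _ => hT p.1 p.2]
  refine Finset.sum_congr rfl fun w _ => ?_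
  rw [Finset.sum_congr rfl (g := fun _ => φ w) fun p hp => by rw [(mem_filter.1 hp).2],
    sum_const, nsmul_eq_mul, reprCount]

lemma sum_reprCount_le [Add α] (f : V → α) (T : Finset α) :
    ∑ w ∈ T, reprCount f w ≤ Fintype.card V ^ 2 := by
  rw [sq, ← Fintype.card_prod, ← card_univ]
  exact (sum_card_fiberwise_eq_card_filter univ T _).trans_le (card_filter_le ..)

end Representations

section Letters

variable {q : ℕ} [NeZero q]

/-- The representative in `{0, …, q - 1}` of a residue: `intVec` acts by `letter` on each entry. -/
def letter {q : ℕ} (x : ZMod q) : ℤ := x.val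

lemma letter_injective : Function.Injective (letter (q := q)) :=
  Nat.cast_injective.comp (ZMod.val_injective q)

lemma intVec_injective {n : ℕ} : Function.Injective (intVec (q := q) (n := n)) :=
  letter_injective.comp_left

lemma reprCount_intVec {n : ℕ} (w : Fin n → ℤ) :
    reprCount (intVec (q := q)) w = ∏ i, reprCount (letter (q := q)) (w i) :=
  reprCount_comp_left letter w

lemma range_letter : Set.range (letter (q := q)) = alphabet q := by
  ext z
  constructor
  · rintro ⟨x, rfl⟩
    exact ⟨Int.natCast_nonneg _, Int.ofNat_lt.2 (ZMod.val_lt x)⟩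
  · rintro ⟨h0, hq⟩
    lift z to ℕ using h0
    exact ⟨z, by rw [letter, ZMod.val_cast_of_lt (Int.ofNat_lt.1 hq)]⟩

lemma letter_add_letter_mem_Icc (x y : ZMod q) :
    letter x + letter y ∈ Icc (0 : ℤ) (2 * (q : ℤ) - 2) := by
  have hx := ZMod.val_lt x
  have hy := ZMod.val_lt y
  rw [mem_Icc, letter, letter]
  omega

lemma lawW_real_singleton (a : ℤ) :
    (lawW q).real {a} = reprCount (letter (q := q)) a / (q : ℝ) ^ 2 := by
  have fibre (x : ZMod q) : #{z : ZMod q | letter z = letter x} = 1 := by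
    simp [letter_injective.eq_iff, filter_eq']
  rw [lawW, ← range_letter, sumLaw_range fibre fibre, map_measureReal_apply
    (measurable_of_finite _) (measurableSet_singleton a), uniformOn_univ_real_apply]
  simp only [Set.mem_preimage, Set.mem_singleton_iff]
  rw [expect_ind_eq_card_div, Fintype.card_prod, ZMod.card, Nat.cast_mul, sq, reprCount]

/-- Given `U₁ + U₂ = a`, the pair `(U₁, U₂)` is uniform on the `reprCount letter a` representations
of `a`, so both sides are the conditional entropy `H(U₁, U₂ | U₁ + U₂)`. -/
lemma expect_logb_reprCount_letter :
    𝔼 z : ZMod q × ZMod q, Real.logb 2 (reprCount (letter (q := q)) (letter z.1 + letter z.2)) =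
      Real.logb 2 q - threshold q := by
  have hq : (q : ℝ) ≠ 0 := NeZero.ne _
  have entropy_term (x : ℝ) : x / (q : ℝ) ^ 2 * Real.logb 2 (x / (q : ℝ) ^ 2) =
      (x * Real.logb 2 x) / (q : ℝ) ^ 2 - x * 1 * (2 * Real.logb 2 q / (q : ℝ) ^ 2) := by
    by_cases hx : x = 0
    · simp [hx]
    · rw [Real.logb_div hx (by positivity), Real.logb_pow]
      push_cast
      ring
  have entropy_eq : entropyW q = 2 * Real.logb 2 q -
      𝔼 z : ZMod q × ZMod q,
        Real.logb 2 (reprCount (letter (q := q)) (letter z.1 + letter z.2)) := by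
    simp only [entropyW, lawW_real_singleton, entropy_term]
    rw [Finset.sum_sub_distrib, ← Finset.sum_div, ← Finset.sum_mul,
      sum_reprCount_mul letter_add_letter_mem_Icc fun a =>
        Real.logb 2 (reprCount (letter (q := q)) a),
      sum_reprCount_mul letter_add_letter_mem_Icc fun _ => 1, Fintype.expect_eq_sum_div_card]
    simp only [sum_const, card_univ, Fintype.card_prod, ZMod.card, nsmul_eq_mul]
    push_cast
    field_simp
    ring
  rw [threshold, entropy_eq]
  ring

lemma threshold_nonneg : 0 ≤ threshold q := by
  have expect_le : 𝔼 z : ZMod q × ZMod q,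
      Real.logb 2 (reprCount (letter (q := q)) (letter z.1 + letter z.2)) ≤ Real.logb 2 q := by
    refine Finset.expect_le univ_nonempty fun z _ => ?_
    refine Real.logb_le_logb_of_le one_lt_two (Nat.cast_pos.2 (reprCount_pos ..)) ?_
    exact_mod_cast (reprCount_le_card letter_injective _).trans_eq (ZMod.card q)
  rw [expect_logb_reprCount_letter] at expect_le
  linarith

end Letters

section PairSums

variable {q n k : ℕ}

lemma generatorLaw_real [NeZero q] (P : Matrix (Fin n) (Fin k) (ZMod q) → Prop) :
    (generatorLaw q n k).real {g | P (Matrix.of g)} = 𝔼 G, ind (P G) := by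
  rw [generatorLaw, pi_uniformOn_univ, pi_uniformOn_univ, uniformOn_univ_real_apply]
  rfl

/-- The sum of the coset word with message `p.1` and the codeword with message `p.2`. -/
def pairSum (G : Matrix (Fin n) (Fin k) (ZMod q)) (d : Fin n → ZMod q)
    (p : (Fin k → ZMod q) × (Fin k → ZMod q)) : Fin n → ℤ :=
  intVec (G *ᵥ p.1 + d) + intVec (G *ᵥ p.2)

variable (G : Matrix (Fin n) (Fin k) (ZMod q)) (d : Fin n → ZMod q)

lemma mem_code_add_coset_iff (w : Fin n → ℤ) :
    w ∈ code G + coset G d ↔ ∃ p, pairSum G d p = w := by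
  simp only [code, coset, Set.mem_add, Set.exists_mem_image, Set.exists_range_iff, Prod.exists,
    pairSum]
  rw [exists_comm]
  simp only [add_comm]

variable [NeZero q]

lemma inducedLaw_eq_map : inducedLaw G d = (uniformOn Set.univ).map (pairSum G d) := by
  have coset_fibre (x : Fin k → ZMod q) :
      #{z | intVec (G *ᵥ z + d) = intVec (G *ᵥ x + d)} = #{z | G *ᵥ z = 0} := by
    simpa only [intVec_injective.eq_iff, add_left_inj] using card_fibre_mulVec G x
  have code_fibre (x : Fin k → ZMod q) :
      #{z | intVec (G *ᵥ z) = intVec (G *ᵥ x)} = #{z | G *ᵥ z = 0} := by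
    simpa only [intVec_injective.eq_iff] using card_fibre_mulVec G x
  rw [inducedLaw, code, coset, ← Set.range_comp, ← Set.range_comp]
  exact sumLaw_range coset_fibre code_fibre

instance isProbabilityMeasure_inducedLaw : IsProbabilityMeasure (inducedLaw G d) := by
  rw [inducedLaw_eq_map]
  exact Measure.isProbabilityMeasure_map (measurable_of_finite _).aemeasurable

lemma inducedLaw_real (S : Set (Fin n → ℤ)) :
    (inducedLaw G d).real S = 𝔼 p, ind (pairSum G d p ∈ S) := by
  rw [inducedLaw_eq_map, map_measureReal_apply (measurable_of_finite _)
    (Set.to_countable S).measurableSet, uniformOn_univ_real_apply]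
  rfl

lemma inducedLaw_real_singleton (w : Fin n → ℤ) :
    (inducedLaw G d).real {w} =
      (∑ m, ∑ m', ind (pairSum G d (m', m) = w)) / (q : ℝ) ^ (2 * k) := by
  rw [inducedLaw_real, Fintype.expect_eq_sum_div_card, Fintype.sum_prod_type_right,
    Fintype.card_prod, Fintype.card_fun, ZMod.card, Fintype.card_fin, ← pow_add, ← two_mul,
    Nat.cast_pow]
  rfl

lemma le_inducedLaw_real_singleton (p : (Fin k → ZMod q) × (Fin k → ZMod q)) :
    1 / (q : ℝ) ^ (2 * k) ≤ (inducedLaw G d).real {pairSum G d p} := by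
  rw [inducedLaw_real_singleton,
    ← Fintype.sum_prod_type_right fun p' => ind (pairSum G d p' = pairSum G d p)]
  gcongr
  rw [← ind_pos (rfl : pairSum G d p = pairSum G d p)]
  exact Finset.single_le_sum (f := fun p' => ind (pairSum G d p' = pairSum G d p))
    (fun _ _ => ind_nonneg _) (mem_univ p)

end PairSums

section RandomCode

variable {q n k : ℕ} [Fact q.Prime]

/-- Condition on the two messages: linearly dependent pairs account for `(q + 1) / q ^ k`. -/
lemma expect_inducedLaw_le (d : Fin n → ZMod q)
    {S : Matrix (Fin n) (Fin k) (ZMod q) → Set (Fin n → ℤ)} {c : ℝ} (hc : 0 ≤ c)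
    (h : ∀ p : (Fin k → ZMod q) × (Fin k → ZMod q), LinearIndependent (ZMod q) ![p.1, p.2] →
      𝔼 G : Matrix (Fin n) (Fin k) (ZMod q), ind (pairSum G d p ∈ S G) ≤ c) :
    𝔼 G, (inducedLaw G d).real (S G) ≤ (q + 1) / (q : ℝ) ^ k + c := by
  have conditional (p : (Fin k → ZMod q) × (Fin k → ZMod q)) :
      𝔼 G : Matrix (Fin n) (Fin k) (ZMod q), ind (pairSum G d p ∈ S G) ≤
        ind (¬LinearIndependent (ZMod q) ![p.1, p.2]) + c := by
    by_cases hp : LinearIndependent (ZMod q) ![p.1, p.2]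
    · exact (h p hp).trans (le_add_of_nonneg_left (ind_nonneg _))
    · rw [ind_pos hp]
      exact (Finset.expect_le univ_nonempty fun G _ => ind_le_one _).trans
        (le_add_of_nonneg_right hc)
  have dependent := expect_not_linearIndependent_le (F := ZMod q) (κ := Fin k)
  rw [ZMod.card, Fintype.card_fin] at dependent
  simp_rw [inducedLaw_real]
  calc 𝔼 G, 𝔼 p, ind (pairSum G d p ∈ S G) = 𝔼 p, 𝔼 G, ind (pairSum G d p ∈ S G) :=
        Finset.expect_comm ..
    _ ≤ 𝔼 p : (Fin k → ZMod q) × (Fin k → ZMod q),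
          (ind (¬LinearIndependent (ZMod q) ![p.1, p.2]) + c) :=
        Finset.expect_le_expect fun p _ => conditional p
    _ ≤ (q + 1) / (q : ℝ) ^ k + c := by
        rw [Finset.expect_add_distrib, Fintype.expect_const]
        gcongr

lemma expect_pairSum (d : Fin n → ZMod q) {p : (Fin k → ZMod q) × (Fin k → ZMod q)}
    (hp : LinearIndependent (ZMod q) ![p.1, p.2]) (f : (Fin n → ℤ) → ℝ) :
    𝔼 G : Matrix (Fin n) (Fin k) (ZMod q), f (pairSum G d p) =
      𝔼 x : Fin n → ZMod q, 𝔼 y : Fin n → ZMod q, f (intVec x + intVec y) := by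
  unfold pairSum
  rw [expect_mulVec_pair hp fun x y => f (intVec (x + d) + intVec y)]
  exact Fintype.expect_equiv (Equiv.addRight d) _ _ fun x => rfl

end RandomCode

section TypicalSums

variable {q n : ℕ}

/-- The conditional entropy (in bits) of `(U₁, U₂)` given `U₁ + U₂`, for `U₁`, `U₂` independent
and uniform on `{0, …, q - 1}`: the exponent of the number of representations of a typical sum. -/
def reprExponent (q : ℕ) : ℝ := Real.logb 2 q - threshold q

lemma expClose_iff_abs_logb_sub_le {ε a b : ℝ} (ha : 0 < a) :
    ExpClose n ε a b ↔ |Real.logb 2 a - n * b| ≤ n * ε := by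
  rw [ExpClose, ← Real.le_logb_iff_rpow_le one_lt_two ha, ← Real.logb_le_iff_le_rpow one_lt_two ha,
    abs_le]
  constructor <;> rintro ⟨h, h'⟩ <;> constructor <;> linarith

variable [NeZero q]

/-- The variance of the logarithm of the number of representations of `U₁ + U₂`. -/
def logVar (q : ℕ) [NeZero q] : ℝ :=
  Var[fun z : ZMod q × ZMod q =>
    Real.logb 2 (reprCount (letter (q := q)) (letter z.1 + letter z.2)); uniformOn Set.univ]

variable (q) in
/-- The number of representations of `w` as a sum of two vectors with entries in `{0, …, q - 1}`
has the typical exponent up to `δ`. -/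
def IsTypicalSum (δ : ℝ) (w : Fin n → ℤ) : Prop :=
  ExpClose n δ (reprCount (intVec (q := q)) w) (reprExponent q)

lemma isTypicalSum_intVec_add_iff {δ : ℝ} (x y : Fin n → ZMod q) :
    IsTypicalSum q δ (intVec x + intVec y) ↔
      |∑ i, Real.logb 2 (reprCount (letter (q := q)) (letter (x i) + letter (y i))) -
        n * reprExponent q| ≤ n * δ := by
  have entry (i : Fin n) : (intVec x + intVec y) i = letter (x i) + letter (y i) := rfl
  rw [IsTypicalSum, expClose_iff_abs_logb_sub_le (Nat.cast_pos.2 (reprCount_pos ..)),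
    reprCount_intVec, Nat.cast_prod]
  simp only [entry]
  rw [Real.logb_prod _ _ fun i _ => Nat.cast_ne_zero.2 (reprCount_pos ..).ne']

lemma expect_not_isTypicalSum_le (hn : n ≠ 0) {δ : ℝ} (hδ : 0 < δ) :
    𝔼 x : Fin n → ZMod q, 𝔼 y : Fin n → ZMod q, ind (¬IsTypicalSum q δ (intVec x + intVec y)) ≤
      logVar q / (n * δ ^ 2) := by
  have hn' : (0 : ℝ) < n := Nat.cast_pos.2 (Nat.pos_of_ne_zero hn)
  set X : ZMod q × ZMod q → ℝ := fun z =>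
    Real.logb 2 (reprCount (letter (q := q)) (letter z.1 + letter z.2)) with hX
  have mean : ∫ z, X z ∂uniformOn Set.univ = reprExponent q := by
    rw [integral_uniformOn_univ, hX, expect_logb_reprCount_letter, reprExponent]
  have chebyshev := pi_real_le_abs_sum_sub_le (ι := Fin n) (μ := uniformOn Set.univ) (X := X)
    .of_discrete (mul_pos hn' hδ)
  rw [pi_uniformOn_univ, uniformOn_univ_real_apply, mean, Fintype.card_fin] at chebyshev
  calc 𝔼 x : Fin n → ZMod q, 𝔼 y : Fin n → ZMod q, ind (¬IsTypicalSum q δ (intVec x + intVec y))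
      = 𝔼 z : Fin n → ZMod q × ZMod q, ind (n * δ < |∑ i, X (z i) - n * reprExponent q|) := by
        rw [← Finset.expect_product', univ_product_univ]
        refine Fintype.expect_equiv (Equiv.arrowProdEquivProdArrow ..).symm _ _ fun p => ?_
        rw [isTypicalSum_intVec_add_iff, not_le]
        rfl
    _ ≤ _ := Finset.expect_le_expect fun z _ => ind_mono le_of_lt
    _ ≤ n * logVar q / (n * δ) ^ 2 := chebyshev
    _ = logVar q / (n * δ ^ 2) := by field_simp

variable (q n) in
/-- The typical sums of two vectors with entries in `{0, …, q - 1}`. -/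
def typicalSums (δ : ℝ) : Finset (Fin n → ℤ) :=
  open Classical in
  {w ∈ univ.image fun p : (Fin n → ZMod q) × (Fin n → ZMod q) => intVec p.1 + intVec p.2 |
    IsTypicalSum q δ w}

lemma intVec_add_mem_typicalSums {δ : ℝ} {x y : Fin n → ZMod q}
    (h : IsTypicalSum q δ (intVec x + intVec y)) : intVec x + intVec y ∈ typicalSums q n δ := by
  classical
  exact mem_filter.2 ⟨mem_image.2 ⟨(x, y), mem_univ _, rfl⟩, h⟩

lemma card_typicalSums_mul_le (δ : ℝ) :
    #(typicalSums q n δ) * (2 : ℝ) ^ (n * (reprExponent q - δ)) ≤ (q : ℝ) ^ (2 * n) := by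
  classical
  rw [← nsmul_eq_mul]
  refine (card_nsmul_le_sum _ (fun w => (reprCount (intVec (q := q)) w : ℝ)) _
    fun w hw => (mem_filter.1 hw).2.1).trans ?_
  have total := sum_reprCount_le (intVec (q := q)) (typicalSums q n δ)
  rw [Fintype.card_pi, prod_const, card_univ, ZMod.card, Fintype.card_fin, ← pow_mul,
    mul_comm n] at total
  exact_mod_cast total

end TypicalSums

section UpperTail

variable {q n k : ℕ}

/-- `t` is a possible second summand of `w`, when `w` is written as a sum of two vectors with
entries in `{0, …, q - 1}`. -/
def IsSummand (w : Fin n → ℤ) (t : Fin n → ZMod q) : Prop :=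
  ∃ s : Fin n → ZMod q, intVec s + intVec t = w

variable [NeZero q]

lemma expect_ind_isSummand (w : Fin n → ℤ) :
    𝔼 t : Fin n → ZMod q, ind (IsSummand w t) = reprCount (intVec (q := q)) w / (q : ℝ) ^ n := by
  classical
  simp only [IsSummand]
  rw [expect_ind_eq_card_div, reprCount_eq_card_of_injective intVec_injective, Fintype.card_fun,
    ZMod.card, Fintype.card_fin, Nat.cast_pow]

/-- The number of messages whose codeword is a possible summand of `w`, as a real number. -/
def summandCount (G : Matrix (Fin n) (Fin k) (ZMod q)) (w : Fin n → ℤ) : ℝ :=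
  ∑ m : Fin k → ZMod q, ind (IsSummand w (G *ᵥ m))

lemma summandCount_nonneg (G : Matrix (Fin n) (Fin k) (ZMod q)) (w : Fin n → ℤ) :
    0 ≤ summandCount G w :=
  Finset.sum_nonneg fun _ _ => ind_nonneg _

lemma inducedLaw_real_singleton_le (G : Matrix (Fin n) (Fin k) (ZMod q))
    (d : Fin n → ZMod q) (w : Fin n → ℤ) :
    (inducedLaw G d).real {w} ≤ kernelCount G * summandCount G w / (q : ℝ) ^ (2 * k) := by
  rw [inducedLaw_real_singleton, summandCount, Finset.mul_sum]
  gcongr with m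
  by_cases hw : IsSummand w (G *ᵥ m)
  · obtain ⟨s, rfl⟩ := hw
    rw [ind_pos ⟨s, rfl⟩, mul_one]
    simp only [pairSum, add_left_inj, intVec_injective.eq_iff]
    simp only [← eq_sub_iff_add_eq]
    exact sum_ind_mulVec_eq_le G (s - d)
  · rw [ind_neg hw, mul_zero]
    exact (Finset.sum_eq_zero fun m' _ => ind_neg fun h => hw ⟨_, h⟩).le

lemma ind_lt_inducedLaw_le {δ A hi : ℝ} (hA : 0 < A) (hhi : 0 < hi)
    (G : Matrix (Fin n) (Fin k) (ZMod q)) (d : Fin n → ZMod q) (w : Fin n → ℤ) :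
    ind (hi < (inducedLaw G d).real {w}) ≤ ind (¬IsTypicalSum q δ w) + kernelCount G / A +
      A / (hi * (q : ℝ) ^ (2 * k)) * (ind (IsTypicalSum q δ w) * summandCount G w) := by
  have hq : (0 : ℝ) < q := Nat.cast_pos.2 (Nat.pos_of_neZero q)
  have hK := div_nonneg (kernelCount_nonneg G) hA.le
  have hN := summandCount_nonneg G w
  by_cases hw : IsTypicalSum q δ w
  swap
  · rw [ind_pos hw, ind_neg hw, zero_mul, mul_zero]
    linarith [ind_le_one (hi < (inducedLaw G d).real {w})]
  rw [ind_pos hw, ind_neg (not_not.2 hw), zero_add, one_mul]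
  refine ind_le_of_imp (by positivity) fun mass_gt => ?_
  rcases le_or_gt A (kernelCount G) with kernel_ge | kernel_lt
  · exact ((one_le_div hA).2 kernel_ge).trans (le_add_of_nonneg_right (by positivity))
  · refine le_add_of_nonneg_of_le hK ?_
    rw [div_mul_eq_mul_div, one_le_div (by positivity), ← le_div_iff₀ (by positivity)]
    calc hi ≤ kernelCount G * summandCount G w / (q : ℝ) ^ (2 * k) :=
          mass_gt.le.trans (inducedLaw_real_singleton_le G d w)
      _ ≤ A * summandCount G w / (q : ℝ) ^ (2 * k) := by gcongr

variable [Fact q.Prime]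

/-- Messages outside the span of `p` have codewords independent of `pairSum G d p`; those in the
span contribute `q ^ 2`. -/
lemma expect_isTypicalSum_mul_summandCount_le {δ : ℝ} (d : Fin n → ZMod q)
    {p : (Fin k → ZMod q) × (Fin k → ZMod q)} :
    𝔼 G : Matrix (Fin n) (Fin k) (ZMod q),
        ind (IsTypicalSum q δ (pairSum G d p)) * summandCount G (pairSum G d p) ≤
      (q : ℝ) ^ 2 + (q : ℝ) ^ k * (2 ^ (n * (reprExponent q + δ)) / (q : ℝ) ^ n) := by
  set M : ℝ := 2 ^ (n * (reprExponent q + δ)) / (q : ℝ) ^ n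
  have hM : 0 ≤ M := by positivity
  have fresh (w : Fin n → ℤ) :
      𝔼 t : Fin n → ZMod q, ind (IsTypicalSum q δ w) * ind (IsSummand w t) ≤ M := by
    rw [← Finset.mul_expect, expect_ind_isSummand]
    by_cases hw : IsTypicalSum q δ w
    · rw [ind_pos hw, one_mul]
      exact div_le_div_of_nonneg_right hw.2 (by positivity)
    · rwa [ind_neg hw, zero_mul]
  have message (m : Fin k → ZMod q) : 𝔼 G : Matrix (Fin n) (Fin k) (ZMod q),
      ind (IsTypicalSum q δ (pairSum G d p)) * ind (IsSummand (pairSum G d p) (G *ᵥ m)) ≤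
        ind (m ∈ Submodule.span (ZMod q) (Set.range ![p.1, p.2])) + M := by
    by_cases hm : m ∈ Submodule.span (ZMod q) (Set.range ![p.1, p.2])
    · rw [ind_pos hm]
      exact (Finset.expect_le univ_nonempty fun G _ =>
        mul_le_one₀ (ind_le_one _) (ind_nonneg _) (ind_le_one _)).trans
          (le_add_of_nonneg_right hM)
    · rw [ind_neg hm, zero_add]
      have independent := expect_mulVec_of_notMem_span (m := Fin n) hm fun t v =>
        ind (IsTypicalSum q δ (intVec (v 0 + d) + intVec (v 1))) *
          ind (IsSummand (intVec (v 0 + d) + intVec (v 1)) t)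
      exact independent.trans_le (Finset.expect_le univ_nonempty fun G _ => fresh _)
  have span_le := sum_ind_mem_span_pair_le p.1 p.2
  rw [ZMod.card] at span_le
  simp_rw [summandCount, Finset.mul_sum]
  rw [Finset.expect_sum_comm]
  refine (Finset.sum_le_sum fun m _ => message m).trans ?_
  rw [Finset.sum_add_distrib, sum_const, card_univ, Fintype.card_fun, ZMod.card, Fintype.card_fin,
    nsmul_eq_mul, Nat.cast_pow]
  gcongr

lemma expect_upperTail_le (hn : n ≠ 0) {δ A hi : ℝ} (hδ : 0 < δ) (hA : 0 < A) (hhi : 0 < hi)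
    (d : Fin n → ZMod q) :
    𝔼 G : Matrix (Fin n) (Fin k) (ZMod q),
        (inducedLaw G d).real {w | hi < (inducedLaw G d).real {w}} ≤
      (q + 1) / (q : ℝ) ^ k + (logVar q / (n * δ ^ 2) + (1 + (q : ℝ) ^ k / (q : ℝ) ^ n) / A +
        A / (hi * (q : ℝ) ^ (2 * k)) *
          ((q : ℝ) ^ 2 + (q : ℝ) ^ k * (2 ^ (n * (reprExponent q + δ)) / (q : ℝ) ^ n))) := by
  have hV : 0 ≤ logVar q := variance_nonneg ..
  refine expect_inducedLaw_le d (by positivity) fun p hp => ?_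
  have kernel := expect_kernelCount_le (F := ZMod q) (m := Fin n) (κ := Fin k)
  rw [ZMod.card, Fintype.card_fin, Fintype.card_fin] at kernel
  refine (Finset.expect_le_expect fun G _ =>
    ind_lt_inducedLaw_le (δ := δ) hA hhi G d (pairSum G d p)).trans ?_
  rw [Finset.expect_add_distrib, Finset.expect_add_distrib, ← Finset.expect_div,
    ← Finset.mul_expect, expect_pairSum d hp fun w => ind (¬IsTypicalSum q δ w)]
  gcongr
  exacts [expect_not_isTypicalSum_le hn hδ, expect_isTypicalSum_mul_summandCount_le d]

end UpperTail

section LowerTail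

variable {q n k : ℕ}

/-- `w` is congruent modulo `q` to the coset word of a nonzero message. -/
def CongrCosetWord (G : Matrix (Fin n) (Fin k) (ZMod q)) (d : Fin n → ZMod q) (w : Fin n → ℤ) :
    Prop :=
  ∃ s ≠ 0, G *ᵥ s + d = fun i => (w i : ZMod q)

variable [Fact q.Prime]

lemma congrCosetWord_pairSum (G : Matrix (Fin n) (Fin k) (ZMod q)) (d : Fin n → ZMod q)
    {p : (Fin k → ZMod q) × (Fin k → ZMod q)} (hp : LinearIndependent (ZMod q) ![p.1, p.2]) :
    CongrCosetWord G d (pairSum G d p) := by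
  refine ⟨p.1 + p.2, fun h => ?_, funext fun i => ?_⟩
  · exact one_ne_zero (LinearIndependent.pair_iff.1 hp 1 1 (by simpa using h)).1
  · simp only [pairSum, intVec, Pi.add_apply, mulVec_add, Int.cast_add, Int.cast_natCast,
      ZMod.natCast_zmod_val]
    ring

lemma expect_congrCosetWord_le (d : Fin n → ZMod q) (w : Fin n → ℤ) :
    𝔼 G : Matrix (Fin n) (Fin k) (ZMod q), ind (CongrCosetWord G d w) ≤
      (q : ℝ) ^ k / (q : ℝ) ^ n := by
  have message (s : Fin k → ZMod q) : 𝔼 G : Matrix (Fin n) (Fin k) (ZMod q),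
      ind (s ≠ 0 ∧ G *ᵥ s + d = fun i => (w i : ZMod q)) ≤ 1 / (q : ℝ) ^ n := by
    by_cases hs : s = 0
    · rw [Finset.expect_eq_zero fun G _ => ind_neg fun h => h.1 hs]
      positivity
    · have hit := expect_ind_mulVec_eq (m := Fin n) hs ((fun i => (w i : ZMod q)) - d)
      rw [ZMod.card, Fintype.card_fin] at hit
      rw [← hit]
      exact Finset.expect_le_expect fun G _ => ind_mono fun h => eq_sub_of_add_eq h.2
  calc 𝔼 G : Matrix (Fin n) (Fin k) (ZMod q), ind (CongrCosetWord G d w)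
      ≤ 𝔼 G : Matrix (Fin n) (Fin k) (ZMod q), ∑ s : Fin k → ZMod q,
          ind (s ≠ 0 ∧ G *ᵥ s + d = fun i => (w i : ZMod q)) :=
        Finset.expect_le_expect fun G _ => ind_le_sum id
    _ ≤ ∑ s : Fin k → ZMod q, 1 / (q : ℝ) ^ n := by
        rw [Finset.expect_sum_comm]
        exact Finset.sum_le_sum fun s _ => message s
    _ = (q : ℝ) ^ k / (q : ℝ) ^ n := by simp [div_eq_mul_inv]

lemma expect_lowerTail_le (hn : n ≠ 0) {δ lo : ℝ} (hδ : 0 < δ) (hlo : 0 ≤ lo)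
    (d : Fin n → ZMod q) :
    𝔼 G : Matrix (Fin n) (Fin k) (ZMod q),
        (inducedLaw G d).real {w | (inducedLaw G d).real {w} < lo} ≤
      (q + 1) / (q : ℝ) ^ k + logVar q / (n * δ ^ 2) +
        (q : ℝ) ^ (2 * n) / 2 ^ (n * (reprExponent q - δ)) * ((q : ℝ) ^ k / (q : ℝ) ^ n) * lo := by
  classical
  set T : Matrix (Fin n) (Fin k) (ZMod q) → Finset (Fin n → ℤ) := fun G =>
    {w ∈ typicalSums q n δ | CongrCosetWord G d w} with hT
  have outside : 𝔼 G, (inducedLaw G d).real {w | w ∉ T G} ≤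
      (q + 1) / (q : ℝ) ^ k + logVar q / (n * δ ^ 2) := by
    have hV : 0 ≤ logVar q := variance_nonneg ..
    refine expect_inducedLaw_le d (by positivity) fun p hp =>
      le_trans (Finset.expect_le_expect fun G _ => ind_mono fun notMem typical => ?_)
        ((expect_pairSum d hp fun w => ind (¬IsTypicalSum q δ w)).trans_le
          (expect_not_isTypicalSum_le hn hδ))
    exact notMem (mem_filter.2 ⟨intVec_add_mem_typicalSums typical, congrCosetWord_pairSum G d hp⟩)
  have card_le : 𝔼 G, (#(T G) : ℝ) ≤
      (q : ℝ) ^ (2 * n) / 2 ^ (n * (reprExponent q - δ)) * ((q : ℝ) ^ k / (q : ℝ) ^ n) := by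
    simp_rw [hT, ← sum_ind]
    rw [Finset.expect_sum_comm]
    refine (sum_le_card_nsmul _ _ _ fun w _ => expect_congrCosetWord_le d w).trans ?_
    rw [nsmul_eq_mul]
    gcongr
    rw [le_div_iff₀ (by positivity)]
    exact card_typicalSums_mul_le δ
  have split (G : Matrix (Fin n) (Fin k) (ZMod q)) :
      (inducedLaw G d).real {w | (inducedLaw G d).real {w} < lo} ≤
        (inducedLaw G d).real {w | w ∉ T G} + #(T G) * lo := by
    refine (measureReal_mono fun w hw => ?_).trans ((measureReal_union_le _ _).trans
      (add_le_add_right (measureReal_mem_and_singleton_lt_le (inducedLaw G d) (T G) hlo) _))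
    exact (em (w ∈ T G)).symm.imp_right fun hwT => ⟨hwT, hw⟩
  refine (Finset.expect_le_expect fun G _ => split G).trans ?_
  rw [Finset.expect_add_distrib, ← Finset.expect_mul]
  gcongr

end LowerTail

section Asymptotics

lemma exists_antitone_tendsto_zero {Q : ℝ → ℕ → Prop} (h : ∀ δ > 0, ∀ᶠ n in atTop, Q δ n) :
    ∃ δ : ℕ → ℝ, Antitone δ ∧ Tendsto δ atTop (𝓝 0) ∧ ∀ᶠ n in atTop, Q (δ n) n := by
  classical
  obtain ⟨φ, φ_strictMono, hφ⟩ := extraction_forall_of_eventually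
    (P := fun j N => ∀ n ≥ N, Q (1 / (j + 1)) n) fun j =>
      eventually_forall_ge_atTop.2 (h (1 / ((j : ℝ) + 1)) (by positivity))
  let J : ℕ → ℕ := fun n => Nat.findGreatest (φ · ≤ n) n
  have J_mono : Monotone J := fun m n hmn =>
    Nat.findGreatest_mono (fun j hj => hj.trans hmn) hmn
  have J_tendsto : Tendsto J atTop atTop := J_mono.tendsto_atTop_atTop fun j =>
    ⟨φ j, Nat.le_findGreatest φ_strictMono.le_apply le_rfl⟩
  refine ⟨fun n => 1 / (J n + 1), fun m n hmn => ?_,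
    tendsto_one_div_add_atTop_nhds_zero_nat.comp J_tendsto, ?_⟩
  · have := J_mono hmn
    dsimp only
    gcongr
  · filter_upwards [eventually_ge_atTop (φ 0)] with n hn
    exact hφ _ n (Nat.findGreatest_spec (P := (φ · ≤ n)) (Nat.zero_le n) hn)

lemma tendsto_two_rpow_neg_mul {c : ℝ} (hc : 0 < c) :
    Tendsto (fun n : ℕ => (2 : ℝ) ^ (n * -c)) atTop (𝓝 0) :=
  (tendsto_rpow_atBot_of_base_gt_one 2 one_lt_two).comp
    (tendsto_natCast_atTop_atTop.atTop_mul_const_of_neg (neg_lt_zero.2 hc))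

lemma two_rpow_mul_le {n : ℕ} {x y : ℝ} (h : x ≤ y) : (2 : ℝ) ^ (n * x) ≤ 2 ^ (n * y) :=
  Real.rpow_le_rpow_of_exponent_le one_le_two (by gcongr)

variable {q : ℕ} {R ε : ℝ}

lemma sumsetExponent_le_two_mul : sumsetExponent q R ≤ 2 * R := by
  rw [sumsetExponent]
  split_ifs <;> linarith

lemma sumsetExponent_le_add_threshold : sumsetExponent q R ≤ R + threshold q := by
  rw [sumsetExponent]
  split_ifs <;> linarith

lemma pow_eq_two_rpow [NeZero q] {n : ℕ} (hn : n ≠ 0) (k : ℕ) :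
    (q : ℝ) ^ k = 2 ^ (n * (k / n * Real.logb 2 q)) := by
  have hq : (0 : ℝ) < q := Nat.cast_pos.2 (Nat.pos_of_neZero q)
  rw [← mul_assoc, mul_div_cancel₀ _ (Nat.cast_ne_zero.2 hn), mul_comm, Real.rpow_mul two_pos.le,
    Real.rpow_logb two_pos (by norm_num) hq, Real.rpow_natCast]

lemma pow_two_mul_eq_two_rpow [NeZero q] {n : ℕ} (hn : n ≠ 0) (k : ℕ) :
    (q : ℝ) ^ (2 * k) = 2 ^ (n * (2 * (k / n * Real.logb 2 q))) := by
  rw [pow_eq_two_rpow hn, Nat.cast_mul, Nat.cast_ofNat, mul_div_assoc, mul_assoc 2]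

lemma pow_self_eq_two_rpow [NeZero q] (n : ℕ) : (q : ℝ) ^ n = 2 ^ (n * Real.logb 2 q) := by
  have hq : (0 : ℝ) < q := Nat.cast_pos.2 (Nat.pos_of_neZero q)
  rw [mul_comm, Real.rpow_mul two_pos.le, Real.rpow_logb two_pos (by norm_num) hq,
    Real.rpow_natCast]

/-- A bound for both tails of the induced law, once the rate of the code is within `δ` of its
limit. -/
def tailBound (q : ℕ) [NeZero q] (δ : ℝ) (n : ℕ) : ℝ :=
  logVar q / (n * δ ^ 2) + (q ^ 2 + q + 4) * 2 ^ (n * -δ)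

lemma tendsto_tailBound [NeZero q] {δ : ℝ} (hδ : 0 < δ) :
    Tendsto (fun n => tailBound q δ n) atTop (𝓝 0) := by
  have chebyshev : Tendsto (fun n : ℕ => logVar q / (n * δ ^ 2)) atTop (𝓝 0) :=
    (tendsto_natCast_atTop_atTop.atTop_mul_const (by positivity)).const_div_atTop _
  simpa only [tailBound, mul_zero, add_zero] using
    chebyshev.add ((tendsto_two_rpow_neg_mul hδ).const_mul ((q : ℝ) ^ 2 + q + 4))

lemma inv_pow_le_two_rpow [NeZero q] {n k : ℕ} {δ : ℝ} (hn : n ≠ 0)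
    (hδ : δ ≤ k / n * Real.logb 2 q) : ((q : ℝ) ^ k)⁻¹ ≤ 2 ^ (n * -δ) := by
  rw [pow_eq_two_rpow hn, ← Real.rpow_neg two_pos.le, ← mul_neg]
  exact two_rpow_mul_le (neg_le_neg hδ)

variable [Fact q.Prime]

lemma expect_upperTail_le_tailBound {n k : ℕ} {δ : ℝ} (hn : n ≠ 0) (hk : k ≤ n) (hδ : 0 < δ)
    (hδR : 2 * δ ≤ R) (hδε : 4 * δ ≤ ε) (rate : |k / n * Real.logb 2 q - R| ≤ δ)
    (d : Fin n → ZMod q) :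
    𝔼 G : Matrix (Fin n) (Fin k) (ZMod q), (inducedLaw G d).real
        {w | 2 ^ (n * (-sumsetExponent q R + ε)) < (inducedLaw G d).real {w}} ≤
      tailBound q δ n := by
  have hq : (1 : ℝ) ≤ q := Nat.one_le_cast.2 (Nat.pos_of_neZero q)
  obtain ⟨le_rate, -⟩ := abs_le.1 rate
  have sparse : (q : ℝ) ^ k / q ^ n ≤ 1 :=
    div_le_one_of_le₀ (pow_le_pow_right₀ hq hk) (by positivity)
  have dependent := inv_pow_le_two_rpow hn (show δ ≤ k / n * Real.logb 2 q by linarith)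
  have b_le := sumsetExponent_le_two_mul (q := q) (R := R)
  have b_le' := sumsetExponent_le_add_threshold (q := q) (R := R)
  have pair : (2 : ℝ) ^ (n * δ) / (2 ^ (n * (-sumsetExponent q R + ε)) * q ^ (2 * k)) ≤
      2 ^ (n * -δ) := by
    rw [pow_two_mul_eq_two_rpow hn, ← Real.rpow_add two_pos, ← Real.rpow_sub two_pos, ← mul_add,
      ← mul_sub]
    exact two_rpow_mul_le (by linarith)
  have triple : (2 : ℝ) ^ (n * δ) / (2 ^ (n * (-sumsetExponent q R + ε)) * q ^ (2 * k)) *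
      (q ^ k * (2 ^ (n * (reprExponent q + δ)) / q ^ n)) ≤ 2 ^ (n * -δ) := by
    rw [pow_two_mul_eq_two_rpow hn, pow_eq_two_rpow hn k, pow_self_eq_two_rpow,
      ← Real.rpow_add two_pos, ← Real.rpow_sub two_pos, ← Real.rpow_sub two_pos,
      ← Real.rpow_add two_pos, ← Real.rpow_add two_pos, ← mul_add, ← mul_sub, ← mul_sub, ← mul_add,
      ← mul_add, reprExponent]
    exact two_rpow_mul_le (by linarith)
  refine (expect_upperTail_le (A := 2 ^ (n * δ)) hn hδ (by positivity) (by positivity) d).trans ?_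
  rw [div_eq_mul_inv, div_eq_mul_inv (1 + _), ← Real.rpow_neg two_pos.le, ← mul_neg,
    mul_add _ (_ ^ 2), tailBound]
  nlinarith [mul_le_mul_of_nonneg_left dependent (show (0 : ℝ) ≤ q + 1 by positivity),
    mul_le_mul_of_nonneg_right sparse (show (0 : ℝ) ≤ 2 ^ (n * -δ) by positivity),
    mul_le_mul_of_nonneg_right pair (show (0 : ℝ) ≤ q ^ 2 by positivity)]

lemma expect_lowerTail_le_tailBound {n k : ℕ} {δ : ℝ} (hn : n ≠ 0) (hδ : 0 < δ)
    (hδR : 2 * δ ≤ R) (hδε : 4 * δ ≤ ε) (rate : |k / n * Real.logb 2 q - R| ≤ δ)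
    (hR : threshold q < R) (d : Fin n → ZMod q) :
    𝔼 G : Matrix (Fin n) (Fin k) (ZMod q), (inducedLaw G d).real
        {w | (inducedLaw G d).real {w} < 2 ^ (n * (-sumsetExponent q R - ε))} ≤
      tailBound q δ n := by
  obtain ⟨le_rate, rate_le⟩ := abs_le.1 rate
  have dependent := inv_pow_le_two_rpow hn (show δ ≤ k / n * Real.logb 2 q by linarith)
  have coset_words : (q : ℝ) ^ (2 * n) / 2 ^ (n * (reprExponent q - δ)) * (q ^ k / q ^ n) *
      2 ^ (n * (-sumsetExponent q R - ε)) ≤ 2 ^ (n * -δ) := by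
    rw [pow_two_mul_eq_two_rpow hn, div_self (Nat.cast_ne_zero.2 hn), one_mul,
      pow_eq_two_rpow hn k, pow_self_eq_two_rpow, ← Real.rpow_sub two_pos, ← Real.rpow_sub two_pos,
      ← Real.rpow_add two_pos, ← Real.rpow_add two_pos, ← mul_sub, ← mul_sub, ← mul_add, ← mul_add,
      reprExponent, sumsetExponent, if_neg hR.not_ge]
    exact two_rpow_mul_le (by linarith)
  refine (expect_lowerTail_le (lo := 2 ^ (n * (-sumsetExponent q R - ε))) hn hδ
    (by positivity) d).trans ?_
  rw [div_eq_mul_inv, tailBound]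
  nlinarith [mul_le_mul_of_nonneg_left dependent (show (0 : ℝ) ≤ q + 1 by positivity),
    show (0 : ℝ) ≤ (q ^ 2 + 2) * 2 ^ (n * -δ) by positivity]

variable {k : ℕ → ℕ}

lemma tendsto_expect_upperTail (hk : ∀ n, k n ≤ n)
    (hR : Tendsto (fun n : ℕ => (k n : ℝ) / n * Real.logb 2 q) atTop (𝓝 R))
    (d : ∀ n, Fin n → ZMod q) (hε : 0 < ε) :
    Tendsto (fun n => 𝔼 G : Matrix (Fin n) (Fin (k n)) (ZMod q), (inducedLaw G (d n)).real
      {w | 2 ^ (n * (-sumsetExponent q R + ε)) < (inducedLaw G (d n)).real {w}})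
      atTop (𝓝 0) := by
  rcases le_or_gt R 0 with R_nonpos | R_pos
  · refine tendsto_const_nhds.congr fun n => (Finset.expect_eq_zero fun G _ => ?_).symm
    have b_nonpos : sumsetExponent q R ≤ 0 := sumsetExponent_le_two_mul.trans (by linarith)
    convert measureReal_empty
    refine Set.eq_empty_of_forall_notMem fun w => ?_
    rw [Set.mem_ofPred_eq, not_lt]
    exact measureReal_le_one.trans
      (Real.one_le_rpow one_le_two (mul_nonneg n.cast_nonneg (by linarith)))
  · have hδ : 0 < min (ε / 4) (R / 2) := by positivity
    refine squeeze_zero' (Eventually.of_forall fun n =>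
      Finset.expect_nonneg fun G _ => measureReal_nonneg) ?_ (tendsto_tailBound (q := q) hδ)
    filter_upwards [eventually_ne_atTop 0, Metric.tendsto_nhds.1 hR _ hδ] with n hn rate
    exact expect_upperTail_le_tailBound hn (hk n) hδ (by linarith [min_le_right (ε / 4) (R / 2)])
      (by linarith [min_le_left (ε / 4) (R / 2)]) rate.le (d n)

lemma tendsto_expect_lowerTail
    (hR : Tendsto (fun n : ℕ => (k n : ℝ) / n * Real.logb 2 q) atTop (𝓝 R))
    (d : ∀ n, Fin n → ZMod q) (hε : 0 < ε) :
    Tendsto (fun n => 𝔼 G : Matrix (Fin n) (Fin (k n)) (ZMod q), (inducedLaw G (d n)).real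
      {w | (inducedLaw G (d n)).real {w} < 2 ^ (n * (-sumsetExponent q R - ε))})
      atTop (𝓝 0) := by
  rcases le_or_gt R (threshold q) with hRD | hRD
  · refine tendsto_const_nhds.congr' ?_
    filter_upwards [eventually_ne_atTop 0,
      hR.eventually_le_const (show R < R + ε / 2 by linarith)] with n hn rate
    refine (Finset.expect_eq_zero fun G _ => ?_).symm
    rw [inducedLaw_real]
    refine Finset.expect_eq_zero fun p _ => ind_neg ?_
    rw [Set.mem_ofPred_eq, not_lt]
    refine le_trans ?_ (le_inducedLaw_real_singleton G (d n) p)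
    rw [one_div, pow_two_mul_eq_two_rpow hn, ← Real.rpow_neg two_pos.le, ← mul_neg _ (_ * _),
      sumsetExponent, if_pos hRD]
    exact two_rpow_mul_le (by linarith)
  · have R_pos : 0 < R := threshold_nonneg.trans_lt hRD
    have hδ : 0 < min (ε / 4) (R / 2) := by positivity
    refine squeeze_zero' (Eventually.of_forall fun n =>
      Finset.expect_nonneg fun G _ => measureReal_nonneg) ?_ (tendsto_tailBound (q := q) hδ)
    filter_upwards [eventually_ne_atTop 0, Metric.tendsto_nhds.1 hR _ hδ] with n hn rate
    exact expect_lowerTail_le_tailBound hn hδ (by linarith [min_le_right (ε / 4) (R / 2)])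
      (by linarith [min_le_left (ε / 4) (R / 2)]) rate.le hRD (d n)

lemma tendsto_expect_not_expClose (hk : ∀ n, k n ≤ n)
    (hR : Tendsto (fun n : ℕ => (k n : ℝ) / n * Real.logb 2 q) atTop (𝓝 R))
    (d : ∀ n, Fin n → ZMod q) (hε : 0 < ε) :
    Tendsto (fun n => 𝔼 G : Matrix (Fin n) (Fin (k n)) (ZMod q), (inducedLaw G (d n)).real
      {w | ¬ExpClose n ε ((inducedLaw G (d n)).real {w}) (-sumsetExponent q R)})
      atTop (𝓝 0) := by
  have tails := (tendsto_expect_lowerTail hR d hε).add (tendsto_expect_upperTail hk hR d hε)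
  rw [add_zero] at tails
  refine squeeze_zero (fun n => Finset.expect_nonneg fun G _ => measureReal_nonneg)
    (fun n => ?_) tails
  rw [← Finset.expect_add_distrib]
  refine Finset.expect_le_expect fun G _ =>
    (measureReal_mono fun w hw => ?_).trans (measureReal_union_le _ _)
  exact (not_and_or.1 hw).imp not_le.1 not_le.1

end Asymptotics

section NormalTypical

variable {q n k : ℕ} {R ε η : ℝ}

/-- The sums whose induced probability has the exponent of a normal typical sumset up to `ε`. -/
def aepSet (R ε : ℝ) (G : Matrix (Fin n) (Fin k) (ZMod q)) (d : Fin n → ZMod q) :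
    Set (Fin n → ℤ) :=
  {w | ExpClose n ε ((inducedLaw G d).real {w}) (-sumsetExponent q R)}

variable [NeZero q]

lemma aepSet_subset (G : Matrix (Fin n) (Fin k) (ZMod q)) (d : Fin n → ZMod q) :
    aepSet R ε G d ⊆ code G + coset G d := by
  intro w hw
  by_contra h
  have null : (inducedLaw G d).real {w} = 0 := by
    rw [inducedLaw_real]
    exact Finset.expect_eq_zero fun p _ =>
      ind_neg fun hp => h ((mem_code_add_coset_iff G d w).2 ⟨p, hp⟩)
  have pos : 0 < (inducedLaw G d).real {w} := (Real.rpow_pos_of_pos two_pos _).trans_le hw.1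
  exact pos.ne' null

lemma finite_code_add_coset (G : Matrix (Fin n) (Fin k) (ZMod q)) (d : Fin n → ZMod q) :
    (code G + coset G d).Finite :=
  ((Set.finite_range _).image _).add ((Set.finite_range _).image _)

lemma expClose_ncard {α : Type*} [MeasurableSpace α] [MeasurableSingletonClass α] {μ : Measure α}
    [IsProbabilityMeasure μ] {b : ℝ} {K : Set α} (K_finite : K.Finite) (hε : 0 ≤ ε)
    (K_close : ∀ w ∈ K, ExpClose n ε (μ.real {w}) (-b)) (le_mass : 2 ^ (-(n * ε)) ≤ μ.real K) :
    ExpClose n (2 * ε) K.ncard b := by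
  have mass : μ.real K = ∑ w ∈ K_finite.toFinset, μ.real {w} := by
    rw [sum_measureReal_singleton, K_finite.coe_toFinset]
  have mass_le : μ.real K ≤ K.ncard * 2 ^ (n * (-b + ε)) := by
    rw [mass, Set.ncard_eq_toFinset_card K K_finite, ← nsmul_eq_mul]
    exact sum_le_card_nsmul _ _ _ fun w hw => (K_close w (K_finite.mem_toFinset.1 hw)).2
  have card_mul_le : K.ncard * 2 ^ (n * (-b - ε)) ≤ μ.real K := by
    rw [mass, Set.ncard_eq_toFinset_card K K_finite, ← nsmul_eq_mul]
    exact card_nsmul_le_sum _ _ _ fun w hw => (K_close w (K_finite.mem_toFinset.1 hw)).1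
  constructor
  · refine le_of_mul_le_mul_right ?_ (Real.rpow_pos_of_pos two_pos (n * (-b + ε)))
    calc (2 : ℝ) ^ (n * (b - 2 * ε)) * 2 ^ (n * (-b + ε)) = 2 ^ (-(n * ε)) := by
          rw [← Real.rpow_add two_pos]
          ring_nf
      _ ≤ K.ncard * 2 ^ (n * (-b + ε)) := le_mass.trans mass_le
  · refine le_of_mul_le_mul_right ?_ (Real.rpow_pos_of_pos two_pos (n * (-b - ε)))
    calc K.ncard * (2 : ℝ) ^ (n * (-b - ε)) ≤ 1 := card_mul_le.trans measureReal_le_one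
      _ ≤ 2 ^ (n * ε) := Real.one_le_rpow one_le_two (by positivity)
      _ = 2 ^ (n * (b + 2 * ε)) * 2 ^ (n * (-b - ε)) := by
          rw [← Real.rpow_add two_pos]
          ring_nf

lemma ExpClose.mono {ε' a b : ℝ} (h : ExpClose n ε a b) (hε : ε ≤ ε') : ExpClose n ε' a b :=
  ⟨(two_rpow_mul_le (by linarith)).trans h.1, h.2.trans (two_rpow_mul_le (by linarith))⟩

lemma isNormalTypical_aepSet {G : Matrix (Fin n) (Fin k) (ZMod q)} {d : Fin n → ZMod q}
    (hε : 0 ≤ ε) (mass_le : (inducedLaw G d).real (aepSet R ε G d)ᶜ ≤ η)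
    (hη : 2 ^ (-(n * ε)) ≤ 1 - η) : IsNormalTypical R (2 * ε) η G d (aepSet R ε G d) := by
  have typical : 1 - η ≤ (inducedLaw G d).real (aepSet R ε G d) := by
    rw [probReal_compl_eq_one_sub (Set.to_countable _).measurableSet] at mass_le
    linarith
  exact
    { subset := aepSet_subset G d
      typical := typical
      size := expClose_ncard ((finite_code_add_coset G d).subset (aepSet_subset G d)) hε
        (fun w hw => hw) (hη.trans typical)
      aep := fun w hw => ExpClose.mono hw (by linarith) }

end NormalTypical

lemma eventually_le_generatorLaw {q : ℕ} [Fact q.Prime] {k : ℕ → ℕ} {R : ℝ} (hk : ∀ n, k n ≤ n)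
    (hR : Tendsto (fun n : ℕ => (k n : ℝ) / n * Real.logb 2 q) atTop (𝓝 R))
    (d : ∀ n, Fin n → ZMod q) {δ : ℝ} (hδ : 0 < δ) :
    ∀ᶠ n in atTop, 1 - δ ≤ (generatorLaw q n (k n)).real
      {g | ∃ K, IsNormalTypical R δ δ (Matrix.of g) (d n) K} := by
  have hη : 0 < min δ (1 / 2) := by positivity
  filter_upwards [(tendsto_expect_not_expClose hk hR d (half_pos hδ)).eventually_le_const
      (show 0 < min δ (1 / 2) * δ by positivity),
    (tendsto_two_rpow_neg_mul (half_pos hδ)).eventually_le_const (show (0 : ℝ) < 1 / 2 by norm_num)]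
    with n atypical_le two_rpow_le
  rw [generatorLaw_real fun G => ∃ K, IsNormalTypical R δ δ G (d n) K]
  set atypicalMass : Matrix (Fin n) (Fin (k n)) (ZMod q) → ℝ := fun G =>
    (inducedLaw G (d n)).real (aepSet R (δ / 2) G (d n))ᶜ
  have markov : 1 - δ ≤ 1 - (𝔼 G, atypicalMass G) / min δ (1 / 2) :=
    sub_le_sub_left ((div_le_iff₀' hη).2 atypical_le) 1
  refine markov.trans
    (one_sub_expect_div_le_expect_ind (fun G => measureReal_nonneg) hη fun G mass_le => ?_)
  have normal := isNormalTypical_aepSet (half_pos hδ).le mass_le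
    (by rw [← mul_neg]; linarith [min_le_right δ (1 / 2)])
  rw [mul_div_cancel₀ δ two_ne_zero] at normal
  exact ⟨_, { normal with typical := by linarith [normal.typical, min_le_left δ (1 / 2)] }⟩

end

end LinearSumset

theorem corollary1 (q : ℕ) [Fact q.Prime] (k : ℕ → ℕ) (hk : ∀ n, k n ≤ n) (R : ℝ)
    (hR : Tendsto (fun n : ℕ => (k n : ℝ) / (n : ℝ) * Real.logb 2 (q : ℝ)) atTop (𝓝 R))
    (d : ∀ n, Fin n → ZMod q) :
    ∃ ε η : ℕ → ℝ, Antitone ε ∧ Tendsto ε atTop (𝓝 0) ∧ Tendsto η atTop (𝓝 0) ∧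
      Tendsto
        (fun n : ℕ => (LinearSumset.generatorLaw q n (k n)).real
          {g | ∃ K : Set (Fin n → ℤ),
            LinearSumset.IsNormalTypical R (ε n) (η n) (Matrix.of g) (d n) K})
        atTop (𝓝 1) := by
  obtain ⟨δ, δ_antitone, δ_tendsto, typical⟩ := LinearSumset.exists_antitone_tendsto_zero
    fun δ hδ => LinearSumset.eventually_le_generatorLaw hk hR d (δ := δ) hδ
  refine ⟨δ, δ, δ_antitone, δ_tendsto, δ_tendsto, ?_⟩
  have lower_tendsto : Tendsto (fun n => 1 - δ n) atTop (𝓝 1) := by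
    simpa only [sub_zero] using δ_tendsto.const_sub 1
  refine tendsto_of_tendsto_of_tendsto_of_le_of_le' lower_tendsto tendsto_const_nhds typical
    (Eventually.of_forall fun n => ?_)
  rw [LinearSumset.generatorLaw_real fun G => ∃ K, LinearSumset.IsNormalTypical _ _ _ G _ K]
  exact Finset.expect_le Finset.univ_nonempty fun G _ => LinearSumset.ind_le_one _
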